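/- Let $b\ge 1$ and $n\ge 0$ be integers. For $1\le i\le b$ the juggling card $C_i$ induces the permutation $\pi_{C_i}$ of the levels $1,\dots,b$ given by $\pi_{C_i}(1)=i$, $\pi_{C_i}(j)=j-1$ for $2\le j\le i$, and $\pi_{C_i}(j)=j$ for $i<j\le b$. A juggling card sequence with $b$ balls and $n$ cards is a sequence $A=C_{i_1}C_{i_2}\cdots C_{i_n}$ with all $i_k\in\{1,\dots,b\}$. Its induced permutation $\pi_A$ is obtained by applying $\pi_{C_{i_1}},\pi_{C_{i_2}},\dots,\pi_{C_{i_n}}$ successively, in this order, and its number of crossings is $Cr(A)=\sum_{k=1}^n(i_k-1)$. **Theorem.** The number of juggling card sequences $A$ with $b$ balls and $n$ cards, at least one of which is $C_b$, such that $\pi_A=\mathrm{id}$ and $Cr(A)=b(b-1)+2$, is $$\binom{n}{b+2}\binom{n}{b-2},$$ where $\binom{n}{k}=0$ for $k<0$ or $k>n$. -/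

import Mathlib

namespace Juggling

/-- The juggling cards `C_1, …, C_b` for `b` balls. The levels are `0, …, b - 1` from bottom
to top, and the element `i` of `Fin b` stands for the card `C_{i+1}`, which throws the ball on the
bottom level to level `i`. -/
abbrev Card (b : ℕ) : Type := Fin b

/-- The label `k` of the card `C_k`, with `1 ≤ k ≤ b`. -/
def label {b : ℕ} (c : Card b) : ℕ := (c : ℕ) + 1

/-- The permutation of the levels induced by a single card: a ball on level `j` on the left of the
card is on level `cardPerm c j` on its right. It sends the bottom level to level `c`, moves each
of the levels `1, …, c` down by one, and fixes the higher levels. -/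
def cardPerm {b : ℕ} (c : Card b) : Equiv.Perm (Fin b) := (Fin.cycleRange c)⁻¹

/-- The tracks of a card, level by level. -/
theorem cardPerm_apply_val {b : ℕ} (c : Card b) (j : Fin b) :
    (cardPerm c j : ℕ) =
      if (j : ℕ) = 0 then (c : ℕ) else if j ≤ c then (j : ℕ) - 1 else (j : ℕ) := by
  obtain ⟨k, rfl⟩ := (Fin.cycleRange c).surjective j
  have h : cardPerm c (Fin.cycleRange c k) = k := by simp [cardPerm]
  simp only [h, Fin.le_def]
  rcases lt_trichotomy k c with hk | hk | hk
  · have e := Fin.coe_cycleRange_of_lt hk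
    rw [Fin.lt_def] at hk
    generalize ((Fin.cycleRange c k : Fin b) : ℕ) = m at e ⊢
    split_ifs <;> omega
  · have e := Fin.coe_cycleRange_of_le hk.le
    rw [if_pos hk] at e
    rw [if_pos e, hk]
  · have e := Fin.cycleRange_of_gt hk
    rw [Fin.lt_def] at hk
    rw [e]
    split_ifs <;> omega

/-- The permutation of the levels induced by a row of cards, traversed from left to right. -/
def listPerm {b : ℕ} : List (Card b) → Equiv.Perm (Fin b)
  | [] => 1
  | c :: l => listPerm l * cardPerm c

/-- `π_A`: a ball that starts on level `j` ends on level `seqPerm A j`. -/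
def seqPerm {b n : ℕ} (A : Fin n → Card b) : Equiv.Perm (Fin b) := listPerm (List.ofFn A)

/-- The number of crossings: the card `C_k` contributes `k - 1`. -/
def crossings {b n : ℕ} (A : Fin n → Card b) : ℕ := ∑ t, (label (A t) - 1)

/-- The sequence uses the card `C_b`. -/
def UsesTopCard {b n : ℕ} (A : Fin n → Card b) : Prop := ∃ t, label (A t) = b

/-- The binomial coefficient with an integer lower index, equal to `0` if that index is negative. -/
def binom (n : ℕ) (k : ℤ) : ℕ := if 0 ≤ k then n.choose k.toNat else 0

end Juggling

namespace Juggling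

/-! ### Binomial coefficients with an integer lower index -/

/-! Name each ball by its final level and record the ball thrown by each card; rows of cards become
arbitrary words in `b` letters (`ballWord_bijective`). Continue each word by all letters in
increasing order. Initial levels then order the balls by next occurrence (`comesFirst_ballWord`), so
`π_A = id` with `C_b` used means that all letters occur, with increasing first occurrences
(`inOrder_ballWord_iff`). Crossings are the alternations of pairs `i < j`, twice the ascents from
`i` to `j`. Read letter by letter, the ascents add up to jumps; first occurrences contribute `0 + ⋯
+ (b - 1)`, so `b(b-1)+2` crossings mean that the reused letters have total jump 1
(`completes_ballWord_iff`).

Of the past, only the order of recency matters, and of that only the number of letters used, the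
number of letters of jump 0 (records: left-to-right minima) and the number `a` of letters of jump 1
(attached). A telescoping sum (`tagSum_wild`) makes the number of completions affine in `a`
(`IsHistory.wordCount_wild`). The recursions involve sums over the number of records; the binomial
transform makes them local, and the coefficients satisfy them by Pascal's rule (`tameCoeff_succ`,
`wildCoeff_succ`). The first letter is forced, leaving one record and no attached letter, so only
the zeroth coefficient remains, which is the product. -/

theorem binom_succ (n : ℕ) (k : ℤ) : binom (n + 1) k = binom n k + binom n (k - 1) := by
  unfold binom
  rcases lt_trichotomy k 0 with h | rfl | h
  · rw [if_neg (by omega), if_neg (by omega), if_neg (by omega)]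
  · simp
  · obtain ⟨j, rfl⟩ : ∃ j : ℕ, k = j + 1 := ⟨(k - 1).toNat, by omega⟩
    rw [if_pos (by omega), if_pos (by omega), if_pos (by omega)]
    have e1 : ((j : ℤ) + 1).toNat = j + 1 := by omega
    have e2 : ((j : ℤ) + 1 - 1).toNat = j := by omega
    rw [e1, e2, Nat.choose_succ_succ, add_comm]

theorem binom_zero (k : ℤ) : binom 0 k = if k = 0 then 1 else 0 := by
  unfold binom
  split_ifs with h1 h2 h2
  · subst h2; rfl
  · exact Nat.choose_eq_zero_of_lt (by omega)
  · omega
  · rfl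

theorem binom_of_neg (n : ℕ) {k : ℤ} (h : k < 0) : binom n k = 0 := if_neg (by omega)

/-- `binom` with integer values. -/
def zbinom (n : ℕ) (k : ℤ) : ℤ := binom n k

theorem zbinom_succ (n : ℕ) (k : ℤ) : zbinom (n + 1) k = zbinom n k + zbinom n (k - 1) := by
  simp [zbinom, binom_succ]

theorem zbinom_zero (k : ℤ) : zbinom 0 k = if k = 0 then 1 else 0 := by
  simp [zbinom, binom_zero]

theorem zbinom_of_neg (n : ℕ) {k : ℤ} (h : k < 0) : zbinom n k = 0 := by
  simp [zbinom, binom_of_neg n h]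

/-! ### The binomial transform -/

/-- The binomial transform `∑ i, k.choose i * φ i`. -/
def binomTransform : ℕ → (ℕ → ℤ) → ℤ
  | 0, φ => φ 0
  | k + 1, φ => binomTransform k φ + binomTransform k fun i => φ (i + 1)

/-- A sequence delayed by one step. -/
def delay (φ : ℕ → ℤ) : ℕ → ℤ
  | 0 => 0
  | i + 1 => φ i

theorem binomTransform_add (k : ℕ) (φ ψ : ℕ → ℤ) :
    binomTransform k (fun i => φ i + ψ i) = binomTransform k φ + binomTransform k ψ := by
  induction k generalizing φ ψ with
  | zero => rfl
  | succ k ih => simp only [binomTransform, ih]; ring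

theorem binomTransform_succ (k : ℕ) (φ : ℕ → ℤ) :
    binomTransform (k + 1) φ = binomTransform k fun i => φ i + φ (i + 1) := by
  rw [binomTransform_add]; rfl

theorem binomTransform_zero_fun (k : ℕ) : binomTransform k (fun _ => 0) = 0 := by
  induction k with
  | zero => rfl
  | succ k ih => simp [binomTransform, ih]

/-- Hockey stick: the binomials `q.choose i` with `q ≤ k` add up to `k.choose i + k.choose (i + 1)`,
up to `k.choose (i + 1)` counted as the delayed term. -/
theorem sum_binomTransform (k : ℕ) (φ : ℕ → ℤ) :
    ∑ q ∈ Finset.range (k + 1), binomTransform q φ =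
      binomTransform k fun i => φ i + delay φ i := by
  induction k with
  | zero => simp [binomTransform, delay]
  | succ k ih =>
    rw [Finset.sum_range_succ, ih, binomTransform_succ k φ, binomTransform]
    congr 2
    funext i
    simp only [delay]
    ring

theorem sum_sub_mul_binomTransform (k : ℕ) (φ : ℕ → ℤ) :
    ∑ q ∈ Finset.range (k + 1), ((k : ℤ) - q) * binomTransform q φ =
      binomTransform k fun i => delay φ i + delay (delay φ) i := by
  induction k with
  | zero => simp [binomTransform, delay]
  | succ k ih =>
    have h : ∀ q : ℕ, (((k + 1 : ℕ) : ℤ) - q) * binomTransform q φ =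
        ((k : ℤ) - q) * binomTransform q φ + binomTransform q φ := fun q => by push_cast; ring
    rw [Finset.sum_range_succ, sub_self, zero_mul, add_zero]
    simp only [h, Finset.sum_add_distrib, ih, sum_binomTransform]
    rw [binomTransform]
    congr 2

/-! ### The numbers of completions -/

/-- The coefficients of `tameCount`. -/
def tameCoeff (n : ℕ) (r : ℤ) (i : ℕ) : ℤ :=
  zbinom n r * zbinom n (r + i) - zbinom n (r - 1) * zbinom n (r + i + 1)

/-- The number of ways to complete, by `n` letters `r` of which are new, a word without any
excess that has `k + 1` reusable letters. -/
def tameCount (n k : ℕ) (r : ℤ) : ℤ := binomTransform k (tameCoeff n r)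

/-- Pascal's rule in all four factors. The value 0 of the delay is consistent: the determinant in
`tameCoeff` vanishes at `i = -1`. -/
theorem tameCoeff_succ (n : ℕ) (r : ℤ) (i : ℕ) :
    tameCoeff (n + 1) r i = tameCoeff n (r - 1) i + tameCoeff n (r - 1) (i + 1) +
      (tameCoeff n r i + delay (tameCoeff n r) i) := by
  cases i with
  | zero =>
    simp only [tameCoeff, delay, zbinom_succ]
    push_cast
    ring_nf
  | succ i =>
    simp only [tameCoeff, delay, zbinom_succ]
    push_cast
    ring_nf

theorem tameCount_zero (k : ℕ) (r : ℤ) (hr : 0 ≤ r) :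
    tameCount 0 k r = if r = 0 then 1 else 0 := by
  have h : ∀ i, tameCoeff 0 r i = if r = 0 ∧ i = 0 then 1 else 0 := by
    intro i
    simp only [tameCoeff, zbinom_zero]
    split_ifs <;> first | rfl | omega
  have key : ∀ (k : ℕ) (φ : ℕ → ℤ), (∀ i, φ (i + 1) = 0) → binomTransform k φ = φ 0 := by
    intro k
    induction k with
    | zero => intros; rfl
    | succ k ih =>
      intro φ hφ
      simp only [binomTransform, ih φ hφ, hφ, binomTransform_zero_fun, add_zero]
  rw [tameCount, key k _ (fun i => by simp [h]), h]
  simp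

/-- A new letter adds a record; reusing the record with `q` records behind it leaves `q + 1`
records. -/
theorem tameCount_succ (n k : ℕ) (r : ℤ) :
    tameCount (n + 1) k r = tameCount n (k + 1) (r - 1) +
      ∑ q ∈ Finset.range (k + 1), tameCount n q r := by
  simp only [tameCount, sum_binomTransform, binomTransform_succ]
  rw [← binomTransform_add]
  congr 1
  funext i
  rw [tameCoeff_succ]

theorem tameCount_of_neg (n k : ℕ) {r : ℤ} (hr : r < 0) : tameCount n k r = 0 := by
  have : tameCoeff n r = fun _ => 0 := by
    funext i
    simp [tameCoeff, zbinom_of_neg n hr, zbinom_of_neg n (show r - 1 < 0 by omega)]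
  rw [tameCount, this, binomTransform_zero_fun]

/-- The contribution to the number of completions of each letter whose reuse costs one unit of
excess. -/
def attachedCount (n k : ℕ) (r : ℤ) : ℤ := tameCount n (k + 2) r - tameCount n (k + 1) r

theorem attachedCount_succ (n k : ℕ) (r : ℤ) :
    attachedCount (n + 1) k r = attachedCount n (k + 1) (r - 1) + tameCount n (k + 2) r := by
  simp only [attachedCount, tameCount_succ, Finset.sum_range_succ _ (k + 2)]
  ring

theorem attachedCount_eq (n k : ℕ) (r : ℤ) :
    attachedCount n k r =
      binomTransform k fun i => tameCoeff n r (i + 1) + tameCoeff n r (i + 2) := by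
  simp only [attachedCount, tameCount]
  rw [binomTransform, add_sub_cancel_left, binomTransform_succ]

/-- The coefficients of `wildCount`. -/
def wildCoeff (n : ℕ) (r : ℤ) : ℕ → ℤ
  | 0 => zbinom (n + 1) (r - 1) * zbinom (n + 1) (r + 3)
  | i + 1 => zbinom n (r - 2) * zbinom (n + 1) (r + i + 4) +
      zbinom n (r - 1) * zbinom (n + 2) (r + i + 4) +
      zbinom n r * ((i + 1) * zbinom (n + 2) (r + i + 3) - zbinom (n + 1) (r + i + 2))

/-- The number of ways to complete, by `n` letters `r` of which are new, a word that has `k + 1`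
reusable letters and no letter whose reuse costs one unit, with a total excess of one unit. -/
def wildCount (n k : ℕ) (r : ℤ) : ℤ := binomTransform k (wildCoeff n r)

theorem wildCoeff_succ (n : ℕ) (r : ℤ) (i : ℕ) :
    wildCoeff (n + 1) r i = wildCoeff n (r - 1) i + wildCoeff n (r - 1) (i + 1) +
      (wildCoeff n r i + delay (wildCoeff n r) i +
        (delay (fun i => tameCoeff n r (i + 1) + tameCoeff n r (i + 2)) i +
          delay (delay fun i => tameCoeff n r (i + 1) + tameCoeff n r (i + 2)) i)) := by
  -- The double delay vanishes at 0 and 1, so these indices are separate.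
  rcases i with _ | _ | i
  · simp only [wildCoeff, delay, zbinom_succ]
    push_cast
    ring_nf
  · simp only [wildCoeff, tameCoeff, delay, zbinom_succ]
    push_cast
    ring_nf
  · simp only [wildCoeff, tameCoeff, delay, zbinom_succ]
    push_cast
    ring_nf

theorem wildCount_zero (k : ℕ) (r : ℤ) : wildCount 0 k r = 0 := by
  have : wildCoeff 0 r = fun _ => 0 := by
    funext i
    rcases i with _ | i
    · simp only [wildCoeff, zbinom_succ, zbinom_zero]
      split_ifs <;> first | rfl | omega
    · have h4 : zbinom 0 (r - 2) * zbinom 1 (r + i + 4) = 0 := by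
        simp only [zbinom_succ, zbinom_zero]
        split_ifs <;> first | rfl | omega
      have h5 : zbinom 0 (r - 1) * zbinom 2 (r + i + 4) = 0 := by
        simp only [zbinom_succ, zbinom_zero]
        split_ifs <;> first | rfl | omega
      have h6 : zbinom 0 r * ((i + 1) * zbinom 2 (r + i + 3) - zbinom 1 (r + i + 2)) = 0 := by
        by_cases hr : r = 0
        · have a1 : zbinom 2 (r + i + 3) = 0 := by
            simp only [zbinom_succ, zbinom_zero]
            split_ifs <;> first | rfl | omega
          have a2 : zbinom 1 (r + i + 2) = 0 := by
            simp only [zbinom_succ, zbinom_zero]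
            split_ifs <;> first | rfl | omega
          rw [a1, a2]; ring
        · simp [zbinom_zero, hr]
      simp only [wildCoeff, zero_add, h4, h5, h6, add_zero]
  rw [wildCount, this, binomTransform_zero_fun]

/-- The weight `k - q` counts the records in front of the reused one; each of them becomes attached.
-/
theorem wildCount_succ (n k : ℕ) (r : ℤ) :
    wildCount (n + 1) k r = wildCount n (k + 1) (r - 1) +
      ∑ q ∈ Finset.range (k + 1), (wildCount n q r + ((k : ℤ) - q) * attachedCount n q r) := by
  simp only [Finset.sum_add_distrib, wildCount, attachedCount_eq, sum_binomTransform,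
    sum_sub_mul_binomTransform, binomTransform_succ]
  rw [← binomTransform_add, ← binomTransform_add]
  congr 1
  funext i
  rw [wildCoeff_succ]

theorem wildCount_of_neg (n k : ℕ) {r : ℤ} (hr : r < 0) : wildCount n k r = 0 := by
  have : wildCoeff n r = fun _ => 0 := by
    funext i
    rcases i with _ | i
    · simp [wildCoeff, zbinom_of_neg (n + 1) (show r - 1 < 0 by omega)]
    · simp [wildCoeff, zbinom_of_neg n hr, zbinom_of_neg n (show r - 1 < 0 by omega),
        zbinom_of_neg n (show r - 2 < 0 by omega)]
  rw [wildCount, this, binomTransform_zero_fun]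

/-! ### Lists of letters in order of recency -/

/-- The letters smaller than `x` that do not come after `x` in `R`; letters which are not in `R`
come after all others. -/
def jump (R : List ℕ) (x : ℕ) : ℕ :=
  ((Finset.range x).filter fun y => R.idxOf y ≤ R.idxOf x).card

/-- Move the letter `x` to the front, or insert it there. -/
def moveToFront (R : List ℕ) (x : ℕ) : List ℕ := x :: R.erase x

theorem jump_append_cons {u v : List ℕ} {x : ℕ} (h : (u ++ x :: v).Nodup) :
    jump (u ++ x :: v) x = u.countP (· < x) := by
  have hx : x ∉ u := fun hu => by
    simpa using (List.nodup_append.1 h).2.2 x hu x (by simp)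
  have hu : u.Nodup := (List.nodup_append.1 h).1
  rw [jump, List.countP_eq_length_filter, ← List.toFinset_card_of_nodup (hu.filter _)]
  congr 1
  ext y
  simp only [Finset.mem_filter, Finset.mem_range, List.mem_toFinset, List.mem_filter,
    decide_eq_true_eq]
  rw [and_comm, and_congr_left_iff]
  intro hy
  have e : (u ++ x :: v).idxOf x = u.length := by
    rw [List.idxOf_append_of_notMem hx]; simp
  rw [e]
  constructor
  · intro hle
    by_contra hyu
    rw [List.idxOf_append_of_notMem hyu, List.idxOf_cons_ne _ (by omega)] at hle
    omega
  · intro hyu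
    rw [List.idxOf_append_of_mem hyu]
    exact (List.idxOf_lt_length_of_mem hyu).le

theorem moveToFront_append_cons {u v : List ℕ} {x : ℕ} (hx : x ∉ u) :
    moveToFront (u ++ x :: v) x = x :: (u ++ v) := by
  rw [moveToFront, List.erase_append_right _ hx, List.erase_cons_head]

/-- The tags of a list, where `p` and `q` are the two smallest letters in front of it: `true` for
a letter with no smaller letter in front of it, `false` for a letter with exactly one smaller
letter in front of it. Other letters have no tag. -/
def tags : ℕ → ℕ → List ℕ → List Bool
  | _, _, [] => []
  | p, q, y :: v =>
    if y < p then true :: tags y p v else if y < q then false :: tags p y v else tags p q v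

theorem count_true_tags (p q q' : ℕ) (v : List ℕ) (hq : p ≤ q) (hq' : p ≤ q') :
    (tags p q v).count true = (tags p q' v).count true := by
  induction v generalizing p q q' with
  | nil => rfl
  | cons y v ih =>
    unfold tags
    by_cases h : y < p
    · simp [h]
    · simp only [h, if_false]
      split_ifs
      · simp
      · simpa using ih p y q' (by omega) hq'
      · simpa using ih p q y hq (by omega)
      · exact ih p q q' hq hq'

/-- A largest letter in front is smaller than no later letter, so the other tags persist. -/
theorem tags_cons_top (m : ℕ) (v : List ℕ) (h : ∀ y ∈ v, y < m) :
    tags (m + 1) (m + 1) (m :: v) = true :: tags m m v := by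
  rw [tags, if_pos (by omega)]
  cases v with
  | nil => rfl
  | cons y v =>
    have : y < m := h y (by simp)
    simp [tags, this]

/-- The sum over all tags of the values given by `g₀` and `g₁` to the lists obtained by moving the
tagged letters to the front, where `c` is the number of tags `true` in front. -/
def tagSum (g₀ : ℕ → ℕ → ℤ) (g₁ : ℕ → ℤ) : ℕ → List Bool → ℤ
  | _, [] => 0
  | c, true :: v => g₀ (v.count true + 1) (c + v.count false) + tagSum g₀ g₁ (c + 1) v
  | c, false :: v => g₁ (v.count true + 2) + tagSum g₀ g₁ c v

/-- What the scan of a front part `u` of a list with entries below `m` knows about `u`: its two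
smallest letters `p` and `q` and its number `c` of tags `true`. -/
structure Scan (m : ℕ) (u : List ℕ) (p q c : ℕ) : Prop where
  le : p ≤ q
  mem_left : p < m → p ∈ u
  mem_right : q < m → q ∈ u
  record : ∀ x, x < p → u.countP (· < x) = 0 ∧ ∀ v,
    tags m m (x :: (u ++ v)) = true :: (List.replicate c false ++ tags x p v)
  attached : ∀ x, p < x → x < q → u.countP (· < x) = 1 ∧ ∀ v,
    (tags m m (x :: (u ++ v))).count true = (tags p q v).count true + 2
  other : ∀ x, x ∉ u → q < x → x < m → 2 ≤ u.countP (· < x)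

/-- The bound `m` stands in for minima that do not exist yet. -/
theorem Scan.nil (m : ℕ) : Scan m [] m m 0 where
  le := le_rfl
  mem_left h := absurd h (lt_irrefl m)
  mem_right h := absurd h (lt_irrefl m)
  record x hx := ⟨rfl, fun v => by simp [tags, hx]⟩
  attached x h1 h2 := by omega
  other x _ h1 h2 := by omega

/-- Once a smaller `x` is moved to the front, the former record `y` has exactly that one smaller
letter before it; hence one more tag `false`. -/
theorem Scan.snoc_record {m : ℕ} {u : List ℕ} {p q c y : ℕ} (h : Scan m u p q c)
    (hy : y < p) : Scan m (u ++ [y]) y p (c + 1) where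
  le := hy.le
  mem_left _ := by simp
  mem_right hp := by simp [h.mem_left hp]
  record x hx := by
    refine ⟨?_, fun v => ?_⟩
    · simp [(h.record x (by omega)).1, hx.le]
    · rw [List.append_assoc, (h.record x (by omega)).2, List.replicate_succ']
      simp [tags, not_lt.2 hx.le, hy]
  attached x h1 h2 := by
    refine ⟨?_, fun v => ?_⟩
    · simp [(h.record x (by omega)).1, h1]
    · rw [List.append_assoc, (h.record x (by omega)).2]
      simp only [List.count_cons_self, List.count_append, List.singleton_append, tags, h1, if_true]
      rw [count_true_tags y x p v h1.le hy.le]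
      simp [List.count_replicate]
  other x hx h1 h2 := by
    have hxu : x ∉ u := fun hu => hx (by simp [hu])
    have h3 : 1 ≤ u.countP (· < x) := by
      rcases lt_trichotomy x q with hq | rfl | hq
      · exact (h.attached x h1 hq).1.ge
      · exact absurd (h.mem_right h2) hxu
      · exact le_trans (by norm_num) (h.other x hxu hq h2)
    have h4 : [y].countP (· < x) = 1 := by simp; omega
    rw [List.countP_append, h4]
    omega

theorem Scan.snoc_attached {m : ℕ} {u : List ℕ} {p q c y : ℕ} (h : Scan m u p q c)
    (hp : p < y) (hy : y < q) : Scan m (u ++ [y]) p y c where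
  le := hp.le
  mem_left hp := by simp [h.mem_left hp]
  mem_right _ := by simp
  record x hx := by
    refine ⟨?_, fun v => ?_⟩
    · have : ¬ y < x := by omega
      simp [(h.record x hx).1]; omega
    · rw [List.append_assoc, (h.record x hx).2]
      simp [tags, not_lt.2 hp.le, not_lt.2 (hx.trans hp).le]
  attached x h1 h2 := by
    refine ⟨?_, fun v => ?_⟩
    · simp [(h.attached x h1 (by omega)).1, h2.le]
    · rw [List.append_assoc, (h.attached x h1 (by omega)).2]
      simp [tags, not_lt.2 hp.le, hy]
  other x hx h1 h2 := by
    have hxu : x ∉ u := fun hu => hx (by simp [hu])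
    have h3 : 1 ≤ u.countP (· < x) := by
      rcases lt_trichotomy x q with hq | rfl | hq
      · exact (h.attached x (by omega) hq).1.ge
      · exact absurd (h.mem_right h2) hxu
      · exact le_trans (by norm_num) (h.other x hxu hq h2)
    have h4 : [y].countP (· < x) = 1 := by simp; omega
    rw [List.countP_append, h4]
    omega

theorem Scan.snoc_other {m : ℕ} {u : List ℕ} {p q c y : ℕ} (h : Scan m u p q c)
    (hy : q < y) : Scan m (u ++ [y]) p q c where
  le := h.le
  mem_left hp := by simp [h.mem_left hp]
  mem_right hq := by simp [h.mem_right hq]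
  record x hx := by
    have := h.le
    refine ⟨?_, fun v => ?_⟩
    · simp [(h.record x hx).1]; omega
    · rw [List.append_assoc, (h.record x hx).2]
      simp [tags, show ¬ y < x by omega, show ¬ y < p by omega]
  attached x h1 h2 := by
    refine ⟨?_, fun v => ?_⟩
    · simp [(h.attached x h1 h2).1]; omega
    · rw [List.append_assoc, (h.attached x h1 h2).2]
      simp [tags, show ¬ y < q by omega, show ¬ y < p by omega]
  other x hx h1 h2 := by
    rw [List.countP_append]
    exact le_add_right (h.other x (fun hu => hx (by simp [hu])) h1 h2)

/-- Induction on the unscanned part `v`. Its first letter is neither `p` nor `q`, since minima below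
`m` lie in `u` and letters do not repeat; the three remaining ranges are the three kinds of letters.
-/
theorem Scan.sum_eq_tagSum (g₀ : ℕ → ℕ → ℤ) (g₁ : ℕ → ℤ) {m : ℕ} {u v : List ℕ} {p q c : ℕ}
    (h : Scan m u p q c) (hn : (u ++ v).Nodup) (hm : ∀ x ∈ v, x < m) :
    (v.map fun x =>
      if jump (u ++ v) x = 0 then
        g₀ ((tags m m (moveToFront (u ++ v) x)).count true)
          ((tags m m (moveToFront (u ++ v) x)).count false)
      else if jump (u ++ v) x = 1 then
        g₁ ((tags m m (moveToFront (u ++ v) x)).count true)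
      else 0).sum = tagSum g₀ g₁ c (tags p q v) := by
  induction v generalizing u p q c with
  | nil => rfl
  | cons y v ih =>
    have hyu : y ∉ u := fun hu => by
      simpa using (List.nodup_append.1 hn).2.2 y hu y (by simp)
    have hym : y < m := hm y (by simp)
    have e : u ++ y :: v = u ++ [y] ++ v := by simp
    have hn' : (u ++ [y] ++ v).Nodup := e ▸ hn
    have hm' : ∀ x ∈ v, x < m := fun x hx => hm x (by simp [hx])
    rw [List.map_cons, List.sum_cons, jump_append_cons hn, moveToFront_append_cons hyu, e]
    have hle := h.le
    rcases lt_trichotomy y p with hp | rfl | hp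
    · have et : tags p q (y :: v) = true :: tags y p v := by simp [tags, hp]
      rw [ih (h.snoc_record hp) hn' hm', et, (h.record y hp).1,
        (h.record y hp).2, tagSum]
      simp [List.count_replicate]
    · exact absurd (h.mem_left hym) hyu
    · rcases lt_trichotomy y q with hq | rfl | hq
      · have et : tags p q (y :: v) = false :: tags p y v := by simp [tags, hp.not_gt, hq]
        rw [ih (h.snoc_attached hp hq) hn' hm', et,
          (h.attached y hp hq).1, (h.attached y hp hq).2, tagSum,
          count_true_tags p q y v hle hp.le]
        simp
      · exact absurd (h.mem_right hym) hyu
      · have et : tags p q (y :: v) = tags p q v := by simp [tags, hp.not_gt, hq.not_gt]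
        rw [ih (h.snoc_other hq) hn' hm', et]
        have := h.other y hyu hq hym
        rw [if_neg (by omega), if_neg (by omega), zero_add]

theorem sum_eq_tagSum (g₀ : ℕ → ℕ → ℤ) (g₁ : ℕ → ℤ) {m : ℕ} {R : List ℕ}
    (hn : R.Nodup) (hm : ∀ x ∈ R, x < m) :
    (R.map fun x =>
      if jump R x = 0 then
        g₀ ((tags m m (moveToFront R x)).count true) ((tags m m (moveToFront R x)).count false)
      else if jump R x = 1 then g₁ ((tags m m (moveToFront R x)).count true)
      else 0).sum = tagSum g₀ g₁ 0 (tags m m R) :=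
  (Scan.nil m).sum_eq_tagSum g₀ g₁ (by simpa using hn) hm

theorem tagSum_tame (n : ℕ) (r : ℤ) (c : ℕ) (t : List Bool) :
    tagSum (fun h _ => tameCount n (h - 1) r) (fun _ => 0) c t =
      ∑ q ∈ Finset.range (t.count true), tameCount n q r := by
  induction t generalizing c with
  | nil => rfl
  | cons z t ih => cases z <;> simp [tagSum, ih, Finset.sum_range_succ, add_comm]

/-- An attached letter with `j` records behind it yields `tameCount n (j + 1) r` when reused, and
survives the reuse of each record in front of it, adding `attachedCount n q r` for every such
record, with `q` records behind that one. These differences telescope to a total independent of the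
letter's position. -/
theorem tagSum_wild (n : ℕ) (r : ℤ) (c : ℕ) (t : List Bool) :
    tagSum (fun h a => wildCount n (h - 1) r + a * attachedCount n (h - 1) r)
        (fun h => tameCount n (h - 1) r) c t =
      ∑ q ∈ Finset.range (t.count true),
        (wildCount n q r + ((c : ℤ) + t.count true - 1 - q) * attachedCount n q r) +
      t.count false * tameCount n (t.count true + 1) r := by
  induction t generalizing c with
  | nil => simp [tagSum]
  | cons z t ih =>
    cases z
    · simp [tagSum, ih]
      ring
    · simp only [tagSum, ih, List.count_cons_self, Finset.sum_range_succ]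
      have e : (true :: t).count false = t.count false := by simp
      rw [e, Nat.add_sub_cancel]
      have e2 : ∀ q : ℕ, ((c : ℤ) + ((t.count true + 1 : ℕ) : ℤ) - 1 - q) =
          (((c + 1 : ℕ) : ℤ) + t.count true - 1 - q) := fun q => by push_cast; ring
      simp only [e2]
      have e3 : tameCount n (t.count true + 1 + 1) r =
          tameCount n (t.count true + 1) r + attachedCount n (t.count true) r := by
        rw [attachedCount]; ring
      rw [e3]
      push_cast
      ring

/-! ### Counting words -/

/-- The number of words of length `n` with the property `P`. -/
noncomputable def wordCount {α : Type*} (n : ℕ) (P : List α → Prop) : ℕ :=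
  Nat.card {l : List α // l.length = n ∧ P l}

instance finite_words {α : Type*} [Finite α] (n : ℕ) (P : List α → Prop) :
    Finite {l : List α // l.length = n ∧ P l} :=
  ((List.finite_length_eq α n).subset fun _ h => h.1).to_subtype

theorem wordCount_congr {α : Type*} {n : ℕ} {P Q : List α → Prop}
    (h : ∀ l : List α, l.length = n → (P l ↔ Q l)) : wordCount n P = wordCount n Q :=
  Nat.card_congr (Equiv.subtypeEquivRight fun l => and_congr_right fun hl => h l hl)

theorem wordCount_false {α : Type*} {n : ℕ} {P : List α → Prop} (h : ∀ l, ¬ P l) :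
    wordCount n P = 0 :=
  have : IsEmpty {l : List α // l.length = n ∧ P l} := ⟨fun l => h _ l.2.2⟩
  Nat.card_of_isEmpty

theorem wordCount_zero {α : Type*} (P : List α → Prop) [Decidable (P [])] :
    wordCount 0 P = if P [] then 1 else 0 := by
  split_ifs with h
  · have : Unique {l : List α // l.length = 0 ∧ P l} :=
      { default := ⟨[], rfl, h⟩
        uniq := fun l => Subtype.ext (List.eq_nil_of_length_eq_zero l.2.1) }
    exact Nat.card_unique
  · have : IsEmpty {l : List α // l.length = 0 ∧ P l} :=
      ⟨fun l => h (List.eq_nil_of_length_eq_zero l.2.1 ▸ l.2.2)⟩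
    exact Nat.card_of_isEmpty

theorem wordCount_succ {α : Type*} [Fintype α] (n : ℕ) (P : List α → Prop) :
    wordCount (n + 1) P = ∑ x, wordCount n fun l => P (x :: l) := by
  unfold wordCount
  rw [← Nat.card_sigma]
  refine Nat.card_congr
    { toFun := fun l => ⟨l.1.head (List.ne_nil_of_length_eq_add_one l.2.1), l.1.tail,
        by simp [l.2.1],
        by simpa using l.2.2⟩
      invFun := fun s => ⟨s.1 :: s.2.1, by simp [s.2.2.1], s.2.2.2⟩
      left_inv := fun l => Subtype.ext (List.cons_head_tail _)
      right_inv := fun s => rfl }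

/-- The word `l` completes the history recorded by the list `R` of the letters used so far, in
order of recency: the new letters appear in increasing order, all letters get used, and the total
jump of the letters used again is `k`. -/
def Completes {b : ℕ} : List ℕ → ℕ → List (Fin b) → Prop
  | R, k, [] => R.length = b ∧ k = 0
  | R, k, x :: l =>
    if (x : ℕ) < R.length then jump R x ≤ k ∧ Completes (moveToFront R x) (k - jump R x) l
    else (x : ℕ) = R.length ∧ Completes (moveToFront R x) k l

/-- The list `R` is an arrangement of the letters below its length. -/
structure IsHistory (R : List ℕ) : Prop where
  nodup : R.Nodup
  mem_iff : ∀ x, x ∈ R ↔ x < R.length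

theorem IsHistory.perm {R : List ℕ} (h : IsHistory R) : R.Perm (List.range R.length) :=
  (List.perm_ext_iff_of_nodup h.nodup List.nodup_range).2 fun x => by simp [h.mem_iff]

theorem IsHistory.sum_range {R : List ℕ} (h : IsHistory R) (f : ℕ → ℤ) :
    ∑ x ∈ Finset.range R.length, f x = (R.map f).sum := by
  rw [(h.perm.map f).sum_eq, Finset.sum_range, ← List.sum_ofFn, List.ofFn_eq_map,
    ← List.map_coe_finRange_eq_range, List.map_map]
  rfl

theorem IsHistory.length_moveToFront {R : List ℕ} (h : IsHistory R) {x : ℕ} (hx : x < R.length) :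
    (moveToFront R x).length = R.length := by
  rw [moveToFront, List.length_cons, List.length_erase_of_mem ((h.mem_iff x).2 hx)]
  omega

theorem IsHistory.toFront {R : List ℕ} (h : IsHistory R) {x : ℕ} (hx : x < R.length) :
    IsHistory (moveToFront R x) := by
  refine ⟨?_, fun y => ?_⟩
  · simp [moveToFront, h.nodup.erase, h.nodup.mem_erase_iff]
  · rw [h.length_moveToFront hx, moveToFront, List.mem_cons, h.nodup.mem_erase_iff,
      h.mem_iff]
    by_cases e : y = x <;> simp [e, hx]

theorem IsHistory.toFront_length {R : List ℕ} (h : IsHistory R) :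
    moveToFront R R.length = R.length :: R := by
  rw [moveToFront, List.erase_of_not_mem]
  simp [h.mem_iff]

theorem IsHistory.cons {R : List ℕ} (h : IsHistory R) : IsHistory (R.length :: R) := by
  refine ⟨?_, fun y => ?_⟩
  · simp [h.nodup, h.mem_iff]
  · simp only [List.mem_cons, h.mem_iff, List.length_cons]
    omega

theorem isHistory_nil : IsHistory [] := ⟨List.nodup_nil, by simp⟩

/-- The tags of a history. -/
def historyTags (R : List ℕ) : List Bool := tags R.length R.length R

theorem IsHistory.historyTags_cons {R : List ℕ} (h : IsHistory R) :
    historyTags (R.length :: R) = true :: historyTags R :=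
  tags_cons_top _ _ fun _ hy => (h.mem_iff _).1 hy

theorem IsHistory.historyTags_ne_nil {R : List ℕ} (h : IsHistory R) (hR : R ≠ []) :
    1 ≤ (historyTags R).count true := by
  cases R with
  | nil => exact absurd rfl hR
  | cons y v =>
    have : y < (y :: v).length := (h.mem_iff y).1 (by simp)
    rw [historyTags, tags, if_pos this]
    simp

theorem IsHistory.not_completes {b : ℕ} {R : List ℕ} (h : IsHistory R) (hb : b < R.length)
    (k : ℕ) (l : List (Fin b)) : ¬ Completes R k l := by
  induction l generalizing R k with
  | nil => rintro ⟨h, -⟩; omega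
  | cons x l ih =>
    have hx : (x : ℕ) < R.length := x.2.trans hb
    rw [Completes, if_pos hx]
    rintro ⟨-, h2⟩
    exact ih (h.toFront hx) (by rw [h.length_moveToFront hx]; exact hb) _ h2

theorem IsHistory.wordCount_succ {b : ℕ} {R : List ℕ} (h : IsHistory R) (hb : R.length ≤ b)
    (n k : ℕ) :
    (wordCount (n + 1) (Completes (b := b) R k) : ℤ) =
      wordCount n (Completes (b := b) (R.length :: R) k) +
      (R.map fun x => if jump R x ≤ k then
        (wordCount n (Completes (b := b) (moveToFront R x) (k - jump R x)) : ℤ) else 0).sum := by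
  rw [Juggling.wordCount_succ, ← h.sum_range]
  have key : ∀ x : Fin b, (wordCount n fun l => Completes R k (x :: l)) =
      if (x : ℕ) < R.length then (if jump R x ≤ k then
        wordCount n (Completes (b := b) (moveToFront R x) (k - jump R x)) else 0)
      else if (x : ℕ) = R.length then wordCount n (Completes (b := b) (R.length :: R) k)
      else 0 := by
    intro x
    split_ifs with h1 h2 h3
    · exact wordCount_congr fun l _ => by rw [Completes, if_pos h1]; simp [h2]
    · exact wordCount_false fun l => by rw [Completes, if_pos h1]; simp [h2]
    · exact wordCount_congr fun l _ => by
        rw [Completes, if_neg h1, h3, h.toFront_length]; simp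
    · exact wordCount_false fun l => by rw [Completes, if_neg h1]; simp [h3]
  simp only [key]
  rw [Fin.sum_univ_eq_sum_range (fun x => if x < R.length then (if jump R x ≤ k then
        wordCount n (Completes (b := b) (moveToFront R x) (k - jump R x)) else 0)
      else if x = R.length then wordCount n (Completes (b := b) (R.length :: R) k)
      else 0) b]
  obtain ⟨d, rfl⟩ := Nat.exists_eq_add_of_le hb
  rw [Finset.sum_range_add]
  have e1 : ∀ x ∈ Finset.range R.length, (if x < R.length then (if jump R x ≤ k then
        wordCount n (Completes (b := R.length + d) (moveToFront R x) (k - jump R x)) else 0)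
      else if x = R.length then wordCount n (Completes (b := R.length + d) (R.length :: R) k)
      else 0) = if jump R x ≤ k then
        wordCount n (Completes (b := R.length + d) (moveToFront R x) (k - jump R x))
        else 0 :=
    fun x hx => if_pos (Finset.mem_range.1 hx)
  rw [Finset.sum_congr rfl e1]
  push_cast
  rw [add_comm]
  congr 1
  -- Beyond the used letters only `R.length` is admissible. If all `b` letters are used it is
  -- unavailable, and the longer history has no completions.
  cases d with
  | zero =>
    rw [Finset.sum_range_zero, wordCount_false fun l => h.cons.not_completes (by simp) k l]
    rfl
  | succ d =>
    rw [Finset.sum_range_succ', Finset.sum_eq_zero]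
    · simp
    · intro x _
      rw [if_neg (by omega), if_neg (by omega)]

theorem IsHistory.wordCount_tame {b : ℕ} (n : ℕ) {R : List ℕ} (h : IsHistory R) (hR : R ≠ []) :
    (wordCount n (Completes (b := b) R 0) : ℤ) =
      tameCount n ((historyTags R).count true - 1) (b - R.length) := by
  induction n generalizing R with
  | zero =>
    rcases lt_or_ge b R.length with hb | hb
    · rw [wordCount_false fun l => h.not_completes hb 0 l, tameCount_of_neg _ _ (by omega)]
      rfl
    · classical
      rw [Juggling.wordCount_zero, tameCount_zero _ _ (by omega)]
      simp only [Completes, and_true]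
      split_ifs <;> first | rfl | omega
  | succ n ih =>
    rcases lt_or_ge b R.length with hb | hb
    · rw [wordCount_false fun l => h.not_completes hb 0 l, tameCount_of_neg _ _ (by omega)]
      rfl
    have hpos := h.historyTags_ne_nil hR
    rw [h.wordCount_succ hb, ih h.cons (by simp), h.historyTags_cons, tameCount_succ,
      List.count_cons_self, Nat.add_sub_cancel, Nat.sub_add_cancel hpos]
    congr 1
    · congr 1
      push_cast [List.length_cons]
      ring
    · rw [← tagSum_tame _ _ 0, historyTags,
        ← sum_eq_tagSum _ _ h.nodup (fun x hx => (h.mem_iff x).1 hx)]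
      congr 1
      refine List.map_congr_left fun x hx => ?_
      have hx' := (h.mem_iff x).1 hx
      by_cases hj : jump R x = 0
      · rw [if_pos hj.le, if_pos hj, hj, ih (h.toFront hx') (by simp [moveToFront]),
          historyTags, h.length_moveToFront hx']
      · rw [if_neg (by omega), if_neg hj, ite_self]

theorem IsHistory.wordCount_wild_of_lt {b : ℕ} (n : ℕ) {R : List ℕ} (h : IsHistory R)
    (hb : b < R.length) :
    (wordCount n (Completes (b := b) R 1) : ℤ) =
      wildCount n ((historyTags R).count true - 1) (b - R.length) +
      (historyTags R).count false *
        attachedCount n ((historyTags R).count true - 1) (b - R.length) := by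
  rw [wordCount_false fun l => h.not_completes hb 1 l, wildCount_of_neg _ _ (by omega),
    attachedCount, tameCount_of_neg _ _ (by omega), tameCount_of_neg _ _ (by omega)]
  simp

theorem IsHistory.wordCount_wild {b : ℕ} (n : ℕ) {R : List ℕ} (h : IsHistory R) (hR : R ≠ []) :
    (wordCount n (Completes (b := b) R 1) : ℤ) =
      wildCount n ((historyTags R).count true - 1) (b - R.length) +
      (historyTags R).count false *
        attachedCount n ((historyTags R).count true - 1) (b - R.length) := by
  induction n generalizing R with
  | zero =>
    rcases lt_or_ge b R.length with hb | hb
    · exact h.wordCount_wild_of_lt 0 hb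
    · classical
      rw [Juggling.wordCount_zero, wildCount_zero, attachedCount, tameCount_zero _ _ (by omega),
        tameCount_zero _ _ (by omega)]
      simp [Completes]
  | succ n ih =>
    rcases lt_or_ge b R.length with hb | hb
    · exact h.wordCount_wild_of_lt _ hb
    have hpos := h.historyTags_ne_nil hR
    rw [h.wordCount_succ hb, ih h.cons (by simp), h.historyTags_cons, wildCount_succ,
      attachedCount_succ, List.count_cons_self, Nat.add_sub_cancel, Nat.sub_add_cancel hpos]
    have e : (R.map fun x => if jump R x ≤ 1 then
        (wordCount n (Completes (b := b) (moveToFront R x) (1 - jump R x)) : ℤ)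
          else 0).sum =
        tagSum (fun h a => wildCount n (h - 1) (b - R.length) +
          a * attachedCount n (h - 1) (b - R.length))
          (fun h => tameCount n (h - 1) (b - R.length)) 0 (historyTags R) := by
      rw [historyTags, ← sum_eq_tagSum _ _ h.nodup (fun x hx => (h.mem_iff x).1 hx)]
      congr 1
      refine List.map_congr_left fun x hx => ?_
      have hx' := (h.mem_iff x).1 hx
      have hne : moveToFront R x ≠ [] := by simp [moveToFront]
      by_cases hj : jump R x = 0
      · rw [if_pos (by omega), if_pos hj, hj, Nat.sub_zero, ih (h.toFront hx') hne,
          historyTags, h.length_moveToFront hx']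
      · by_cases hj1 : jump R x = 1
        · rw [if_pos (by omega), if_neg hj, if_pos hj1, hj1, Nat.sub_self,
            (h.toFront hx').wordCount_tame n hne, historyTags, h.length_moveToFront hx']
        · rw [if_neg (by omega), if_neg hj, if_neg hj1]
    rw [e, tagSum_wild]
    have e2 : (b : ℤ) - ((R.length :: R).length : ℤ) = b - R.length - 1 := by
      push_cast [List.length_cons]
      ring
    have e3 : (true :: historyTags R).count false = (historyTags R).count false := by simp
    obtain ⟨j, hj⟩ := Nat.exists_eq_add_of_le' hpos
    rw [e2, e3, hj]
    push_cast
    simp only [zero_add, add_sub_cancel_right]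
    ring

theorem wordCount_completes_nil (b n : ℕ) :
    wordCount n (Completes (b := b) [] 1) = binom n (b + 2) * binom n (b - 2) := by
  cases n with
  | zero =>
    classical
    rw [wordCount_zero, binom_zero, binom_zero]
    simp [Completes]
    omega
  | succ n =>
    zify
    -- The empty history has no record, so the general formula applies only after the forced first
    -- letter 0.
    rw [isHistory_nil.wordCount_succ (by simp), isHistory_nil.cons.wordCount_wild n (by simp)]
    simp [historyTags, tags, wildCount, binomTransform, wildCoeff, zbinom]
    ring_nf

/-! ### Crossings of pairs of balls -/

/-- The sum over all pairs `i < j`. -/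
def pairSum {b : ℕ} (f : Fin b → Fin b → ℕ) : ℕ := ∑ i, ∑ j, if i < j then f i j else 0

theorem pairSum_congr {b : ℕ} {f g : Fin b → Fin b → ℕ} (h : ∀ i j, i < j → f i j = g i j) :
    pairSum f = pairSum g :=
  Finset.sum_congr rfl fun i _ => Finset.sum_congr rfl fun j _ => by
    split_ifs with hij
    · exact h i j hij
    · rfl

theorem pairSum_add {b : ℕ} (f g : Fin b → Fin b → ℕ) :
    pairSum (fun i j => f i j + g i j) = pairSum f + pairSum g := by
  simp only [pairSum, ← Finset.sum_add_distrib]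
  exact Finset.sum_congr rfl fun i _ => Finset.sum_congr rfl fun j _ => by split_ifs <;> rfl

theorem pairSum_left {b : ℕ} (x : Fin b) (P : Fin b → Fin b → Prop) [∀ i j, Decidable (P i j)] :
    pairSum (fun i j => if x = i ∧ P i j then 1 else 0) =
      ∑ y, if x < y ∧ P x y then 1 else 0 := by
  rw [pairSum, Finset.sum_comm]
  refine Finset.sum_congr rfl fun j _ => ?_
  rw [Finset.sum_eq_single x (fun i _ hi => by simp [hi.symm]) (by simp)]
  simp [ite_and]

theorem pairSum_right {b : ℕ} (x : Fin b) (P : Fin b → Fin b → Prop) [∀ i j, Decidable (P i j)] :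
    pairSum (fun i j => if x = j ∧ P i j then 1 else 0) =
      ∑ y, if y < x ∧ P y x then 1 else 0 := by
  refine Finset.sum_congr rfl fun i _ => ?_
  rw [Finset.sum_eq_single x (fun j _ hj => by simp [hj.symm]) (by simp)]
  simp [ite_and]

/-- Whether `i` comes before `j` in a word that is continued by increasing letters. -/
def comesFirst {b : ℕ} (i j : Fin b) : List (Fin b) → Bool
  | [] => true
  | x :: w => if x = i then true else if x = j then false else comesFirst i j w

/-- The number of letters `i` and `j` of a word, continued by increasing letters, that are
followed by the other one of these letters. -/
def alternations {b : ℕ} (i j : Fin b) : List (Fin b) → ℕ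
  | [] => 0
  | x :: w => (if x = i ∧ ¬ comesFirst i j w then 1 else 0) +
      (if x = j ∧ comesFirst i j w then 1 else 0) + alternations i j w

/-- The number of letters `j` which are preceded by `i` among the letters `i` and `j`, where `s`
tells whether such a letter `i` comes before the word. -/
def ascents {b : ℕ} (i j : Fin b) : Bool → List (Fin b) → ℕ
  | _, [] => 0
  | s, x :: w =>
    if x = i then ascents i j true w
    else if x = j then (if s then 1 else 0) + ascents i j false w
    else ascents i j s w

/-- Prefix the word with `i` or `j` according to `s`, and append `i`. The right side counts all
changes of letter; changes to `j` are the ascents, and changes to `i` are as many, plus one if the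
prefix is `j`. -/
theorem two_mul_ascents {b : ℕ} {i j : Fin b} (hij : i ≠ j) (s : Bool) (w : List (Fin b)) :
    (if s then 0 else 1) + 2 * ascents i j s w =
      alternations i j w + if s = comesFirst i j w then 0 else 1 := by
  induction w generalizing s with
  | nil => cases s <;> rfl
  | cons x w ih =>
    have h1 := ih true
    have h2 := ih false
    have h3 := ih s
    have e1 : ascents i j s (x :: w) = if x = i then ascents i j true w
        else if x = j then (if s then 1 else 0) + ascents i j false w else ascents i j s w := rfl
    have e2 : alternations i j (x :: w) = (if x = i ∧ ¬ comesFirst i j w then 1 else 0) +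
        (if x = j ∧ comesFirst i j w then 1 else 0) + alternations i j w := rfl
    have e3 : comesFirst i j (x :: w) =
        if x = i then true else if x = j then false else comesFirst i j w := rfl
    rw [e1, e2, e3]
    clear e1 e2 e3
    generalize comesFirst i j w = t at *
    by_cases hi : x = i
    · have hj : x ≠ j := fun h => hij (hi.symm.trans h)
      cases s <;> cases t <;> simp [hi, hij] at h1 h2 h3 ⊢ <;> omega
    · by_cases hj : x = j
      · cases s <;> cases t <;> simp [hj, hij.symm] at h1 h2 h3 ⊢ <;> omega
      · simpa [hi, hj] using h3

/-! ### Words in terms of histories -/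

theorem idxOf_erase_le_iff {x y z : ℕ} (R : List ℕ) (hy : y ≠ x) (hz : z ≠ x) :
    (R.erase x).idxOf y ≤ (R.erase x).idxOf z ↔ R.idxOf y ≤ R.idxOf z := by
  induction R with
  | nil => simp
  | cons a R ih =>
    by_cases ha : a = x
    · subst ha
      rw [List.erase_cons_head, List.idxOf_cons_ne _ hy.symm, List.idxOf_cons_ne _ hz.symm]
      omega
    · rw [List.erase_cons_tail (by simpa using ha)]
      by_cases h1 : a = y
      · subst h1
        simp
      · by_cases h2 : a = z
        · subst h2
          simp [List.idxOf_cons_ne _ h1]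
        · simp [List.idxOf_cons_ne _ h1, List.idxOf_cons_ne _ h2, ih]

/-- The total number of ascents of a word with history `R`. -/
def totalAscents {b : ℕ} (R : List ℕ) (w : List (Fin b)) : ℕ :=
  pairSum fun i j => ascents i j (decide (R.idxOf (i : ℕ) ≤ R.idxOf (j : ℕ))) w

theorem jump_eq_sum {b : ℕ} (R : List ℕ) (x : Fin b) :
    jump R x = ∑ y : Fin b, if y < x ∧ R.idxOf (y : ℕ) ≤ R.idxOf (x : ℕ) then 1 else 0 := by
  have h : Finset.range (x : ℕ) = (Finset.univ.filter fun y : Fin b => y < x).map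
      Fin.valEmbedding := by
    ext y
    simp only [Finset.mem_range, Finset.mem_map, Finset.mem_filter, Finset.mem_univ, true_and,
      Fin.valEmbedding_apply]
    exact ⟨fun hy => ⟨⟨y, hy.trans x.2⟩, hy, rfl⟩, by rintro ⟨z, hz, rfl⟩; exact hz⟩
  rw [jump, h, Finset.filter_map, Finset.card_map, Finset.filter_filter, Finset.card_filter]
  rfl

/-- The letter `x` ends an ascent from each smaller letter more recent than `x`; moving it to the
front updates the flags of all pairs. -/
theorem totalAscents_cons {b : ℕ} (R : List ℕ) (x : Fin b) (w : List (Fin b)) :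
    totalAscents R (x :: w) = jump R x + totalAscents (moveToFront R x) w := by
  rw [jump_eq_sum, ← pairSum_right x fun i j : Fin b => R.idxOf (i : ℕ) ≤ R.idxOf (j : ℕ),
    totalAscents, totalAscents, ← pairSum_add]
  refine pairSum_congr fun i j hij => ?_
  rw [ascents, moveToFront]
  by_cases hi : x = i
  · subst hi
    simp [hij.ne]
  · have hi' : (x : ℕ) ≠ i := fun h => hi (Fin.ext h)
    by_cases hj : x = j
    · subst hj
      simp [hi, List.idxOf_cons_ne _ hi']
    · have hj' : (x : ℕ) ≠ j := fun h => hj (Fin.ext h)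
      simp [hi, hj, List.idxOf_cons_ne _ hi', List.idxOf_cons_ne _ hj',
        idxOf_erase_le_iff R hi'.symm hj'.symm]

theorem IsHistory.jump_length {R : List ℕ} (h : IsHistory R) : jump R R.length = R.length := by
  rw [jump, Finset.filter_true_of_mem, Finset.card_range]
  intro y _
  rw [List.idxOf_of_notMem (a := R.length) (by simp [h.mem_iff])]
  exact List.idxOf_le_length

/-- The letters from `m` on all occur in the word, and their first occurrences are in increasing
order. -/
def InOrder {b : ℕ} : ℕ → List (Fin b) → Prop
  | m, [] => m = b
  | m, x :: w => if (x : ℕ) < m then InOrder m w else (x : ℕ) = m ∧ InOrder (m + 1) w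

/-- First occurrences alone give this much. In `IsHistory.completes_iff` the bound yields `jump R x
≤ k`, so that the truncated subtraction there is exact. -/
theorem IsHistory.le_totalAscents {b : ℕ} {R : List ℕ} (h : IsHistory R) (hb : R.length ≤ b)
    {w : List (Fin b)} (hw : InOrder R.length w) :
    ∑ i ∈ Finset.Ico R.length b, i ≤ totalAscents R w := by
  induction w generalizing R with
  | nil =>
    rw [InOrder] at hw
    simp [hw]
  | cons x w ih =>
    rw [InOrder] at hw
    rw [totalAscents_cons]
    split_ifs at hw with hx
    · have := ih (h.toFront hx) (by rwa [h.length_moveToFront hx])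
        (by rwa [h.length_moveToFront hx])
      rw [h.length_moveToFront hx] at this
      omega
    · have hlt : R.length < b := hw.1 ▸ x.2
      rw [hw.1, h.toFront_length, h.jump_length, Finset.sum_eq_sum_Ico_succ_bot hlt]
      exact Nat.add_le_add_left (ih h.cons hlt hw.2) _

theorem IsHistory.completes_iff {b : ℕ} {R : List ℕ} (h : IsHistory R) (hb : R.length ≤ b)
    (k : ℕ) (w : List (Fin b)) :
    Completes R k w ↔ InOrder R.length w ∧
      totalAscents R w = ∑ i ∈ Finset.Ico R.length b, i + k := by
  induction w generalizing R k with
  | nil =>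
    simp only [Completes, InOrder]
    refine and_congr_right fun e => ?_
    have : totalAscents R ([] : List (Fin b)) = 0 := by simp [totalAscents, ascents, pairSum]
    simp [this, e, eq_comm]
  | cons x w ih =>
    rw [Completes, InOrder, totalAscents_cons]
    split_ifs with hx
    · rw [ih (h.toFront hx) (by rwa [h.length_moveToFront hx]), h.length_moveToFront hx]
      constructor
      · rintro ⟨h1, h2, h3⟩
        exact ⟨h2, by omega⟩
      · rintro ⟨h2, h3⟩
        have := (h.toFront hx).le_totalAscents (by rwa [h.length_moveToFront hx])
          (by rwa [h.length_moveToFront hx] : InOrder (moveToFront R x).length w)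
        rw [h.length_moveToFront hx] at this
        exact ⟨by omega, h2, by omega⟩
    · by_cases hx' : (x : ℕ) = R.length
      · have hlt : R.length < b := hx' ▸ x.2
        rw [hx', h.toFront_length, ih h.cons (by simpa using hlt), h.jump_length,
          Finset.sum_eq_sum_Ico_succ_bot hlt, List.length_cons]
        simp only [true_and, add_assoc, add_right_inj]
      · simp [hx']

theorem inOrder_iff {b : ℕ} {m : ℕ} (hm : m ≤ b) (w : List (Fin b)) :
    InOrder m w ↔ (∀ x : Fin b, m ≤ x → x ∈ w) ∧
      ∀ i j : Fin b, i < j → m ≤ i → comesFirst i j w = true := by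
  induction w generalizing m with
  | nil =>
    simp only [InOrder, List.not_mem_nil, imp_false, not_le, comesFirst, implies_true, and_true]
    constructor
    · rintro rfl x
      exact x.2
    · intro h
      by_contra hne
      exact lt_irrefl m (h ⟨m, by omega⟩)
  | cons x w ih =>
    rw [InOrder]
    split_ifs with hx
    · rw [ih hm]
      refine and_congr (forall₂_congr fun y hy => ?_)
        (forall₂_congr fun i j => forall₂_congr fun hij hi => ?_)
      · have : y ≠ x := fun e => by subst e; omega
        simp [this]
      · have h1 : x ≠ i := fun e => by subst e; omega
        have h2 : x ≠ j := fun e => by subst e; rw [Fin.lt_def] at hij; omega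
        simp [comesFirst, h1, h2]
    · by_cases hx' : (x : ℕ) = m
      · rw [ih (show m + 1 ≤ b by have := x.2; omega)]
        simp only [hx', true_and]
        refine and_congr ⟨fun h y hy => ?_, fun h y hy => ?_⟩
          ⟨fun h i j hij hi => ?_, fun h i j hij hi => ?_⟩
        · by_cases e : y = x
          · simp [e]
          · have : (y : ℕ) ≠ x := fun h => e (Fin.ext h)
            exact List.mem_cons_of_mem _ (h y (by omega))
        · have : y ≠ x := fun e => by subst e; omega
          simpa [this] using h y (by omega)
        · by_cases e : x = i
          · simp [comesFirst, e]
          · have h1 : (x : ℕ) ≠ i := fun h => e (Fin.ext h)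
            have h2 : x ≠ j := fun e => by subst e; rw [Fin.lt_def] at hij; omega
            simpa [comesFirst, e, h2] using h i j hij (by omega)
        · have h1 : x ≠ i := fun e => by subst e; omega
          have h2 : x ≠ j := fun e => by subst e; rw [Fin.lt_def] at hij; omega
          simpa [comesFirst, h1, h2] using h i j hij (by omega)
      · refine iff_of_false (fun h => hx' h.1) fun h => ?_
        have hmx : m < x := by omega
        -- A letter overshooting `m` would come before `m`.
        have := h.2 ⟨m, hmx.trans x.2⟩ x (Fin.lt_def.2 hmx) le_rfl
        have hne : x ≠ ⟨m, hmx.trans x.2⟩ := fun e => hx' (by rw [e])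
        simp [comesFirst, hne] at this

/-! ### From cards to words -/

/-- The balls thrown by a row of cards, where a ball is named after its final level. -/
def ballWord {b : ℕ} : List (Card b) → List (Fin b)
  | [] => []
  | c :: l => listPerm l c :: ballWord l

theorem length_ballWord {b : ℕ} (l : List (Card b)) : (ballWord l).length = l.length := by
  induction l with
  | nil => rfl
  | cons c l ih => simp [ballWord, ih]

theorem ballWord_bijective {b : ℕ} : Function.Bijective (ballWord (b := b)) := by
  constructor
  · intro l
    induction l with
    | nil =>
      rintro (_ | ⟨c', l'⟩) h
      · rfl
      · cases h
    | cons c l ih =>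
      rintro (_ | ⟨c', l'⟩) h
      · cases h
      · obtain ⟨h1, h2⟩ := List.cons.inj h
        obtain rfl := ih h2
        rw [(listPerm l).injective h1]
  · intro w
    induction w with
    | nil => exact ⟨[], rfl⟩
    | cons x w ih =>
      obtain ⟨l, rfl⟩ := ih
      exact ⟨(listPerm l)⁻¹ x :: l, by simp [ballWord]⟩

theorem wordCount_ballWord {b : ℕ} (n : ℕ) (P : List (Fin b) → Prop) :
    wordCount n (fun l : List (Card b) => P (ballWord l)) = wordCount n P :=
  Nat.card_congr ((Equiv.ofBijective _ ballWord_bijective).subtypeEquiv fun l => by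
    simp [length_ballWord])

theorem coe_cycleRange {b : ℕ} (c p : Fin b) :
    (Fin.cycleRange c p : ℕ) = if p = c then 0 else if p < c then (p : ℕ) + 1 else p := by
  split_ifs with h1 h2
  · simpa [h1] using Fin.coe_cycleRange_of_le (le_refl c)
  · exact Fin.coe_cycleRange_of_lt h2
  · rw [Fin.cycleRange_of_gt (lt_of_le_of_ne (not_lt.1 h2) (Ne.symm h1))]

theorem cycleRange_lt_cycleRange {b : ℕ} {c p q : Fin b} (hp : p ≠ c) (hq : q ≠ c) :
    Fin.cycleRange c p < Fin.cycleRange c q ↔ p < q := by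
  have hp' : (p : ℕ) ≠ c := fun h => hp (Fin.ext h)
  have hq' : (q : ℕ) ≠ c := fun h => hq (Fin.ext h)
  simp only [Fin.lt_def, coe_cycleRange, hp, hq, if_false]
  split_ifs <;> omega

theorem listPerm_cons_inv {b : ℕ} (c : Card b) (l : List (Card b)) (y : Fin b) :
    (listPerm (c :: l))⁻¹ y = Fin.cycleRange c ((listPerm l)⁻¹ y) := by
  simp [listPerm, cardPerm]

/-- Prepending a card puts the ball it throws on the bottom level and preserves the order of the
others, just as prepending a letter does for next occurrences. -/
theorem comesFirst_ballWord {b : ℕ} {i j : Fin b} (hij : i < j) (l : List (Card b)) :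
    comesFirst i j (ballWord l) = true ↔ (listPerm l)⁻¹ i < (listPerm l)⁻¹ j := by
  induction l with
  | nil => simp [ballWord, comesFirst, listPerm, hij]
  | cons c l ih =>
    rw [ballWord, comesFirst, listPerm_cons_inv, listPerm_cons_inv]
    by_cases hi : listPerm l c = i
    · have hi' : (listPerm l)⁻¹ i = c := by simp [← hi]
      have hj' : (listPerm l)⁻¹ j ≠ c := fun h =>
        hij.ne ((listPerm l)⁻¹.injective (hi'.trans h.symm))
      simp only [hi, if_true, true_iff, Fin.lt_def, coe_cycleRange, hi', hj', if_false]
      have : ((listPerm l)⁻¹ j : ℕ) ≠ c := fun h => hj' (Fin.ext h)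
      split_ifs <;> omega
    · have hi' : (listPerm l)⁻¹ i ≠ c := fun h => hi (by simp [← h])
      by_cases hj : listPerm l c = j
      · have hj' : (listPerm l)⁻¹ j = c := by simp [← hj]
        rw [if_neg hi, if_pos hj, Fin.lt_def, coe_cycleRange c ((listPerm l)⁻¹ j), if_pos hj']
        simp
      · have hj' : (listPerm l)⁻¹ j ≠ c := fun h => hj (by simp [← h])
        rw [if_neg hi, if_neg hj, ih, cycleRange_lt_cycleRange hi' hj']

/-- After a card throws `x` to level `c`, the `c` balls below it are those whose letters come before
the next `x`: one alternation for each such pair, charged to this throw. -/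
theorem sum_eq_pairSum_alternations {b : ℕ} (l : List (Card b)) :
    (l.map Fin.val).sum = pairSum fun i j => alternations i j (ballWord l) := by
  induction l with
  | nil => simp [ballWord, alternations, pairSum]
  | cons c l ih =>
    rw [List.map_cons, List.sum_cons, ih]
    simp only [ballWord, alternations]
    set x := listPerm l c with hx
    have hc : (listPerm l)⁻¹ x = c := by simp [hx]
    rw [pairSum_add, pairSum_add, pairSum_left, pairSum_right]
    congr 1
    rw [← Finset.sum_add_distrib]
    have e : ∀ y : Fin b, ((if x < y ∧ ¬ comesFirst x y (ballWord l) = true then 1 else 0) +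
        if y < x ∧ comesFirst y x (ballWord l) = true then 1 else 0) =
        if (listPerm l)⁻¹ y < c then 1 else 0 := by
      intro y
      rcases lt_trichotomy x y with h | h | h
      · have hne : (listPerm l)⁻¹ y ≠ c := fun e =>
          h.ne ((listPerm l)⁻¹.injective (hc.trans e.symm))
        simp only [h, h.not_gt, comesFirst_ballWord h, hc, true_and, false_and, if_false, add_zero,
          not_lt]
        simp only [le_iff_lt_or_eq, hne, or_false]
      · simp [← h, hc]
      · simp [h, h.not_gt, comesFirst_ballWord h, hc]
    rw [Finset.sum_congr rfl fun y _ => e y,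
      Equiv.sum_comp (listPerm l)⁻¹ fun p => if p < c then 1 else 0, ← Finset.card_filter,
      Finset.filter_gt_eq_Iio, Fin.card_Iio]

/-- Only the top card moves the ball off the top level, so before its first use that ball is neither
moved nor thrown. -/
theorem mem_ballWord_top {b : ℕ} {t : Fin b} (ht : (t : ℕ) + 1 = b) (l : List (Card b)) :
    (t ∈ ballWord l ↔ t ∈ l) ∧ (t ∉ ballWord l → (listPerm l)⁻¹ t = t) := by
  induction l with
  | nil => simp [ballWord, listPerm]
  | cons c l ih =>
    rw [ballWord, listPerm_cons_inv, List.mem_cons, List.mem_cons, ih.1]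
    by_cases h : t ∈ l
    · simp [h]
    · have e := ih.2 (mt ih.1.1 h)
      have e' : t = listPerm l c ↔ t = c := by
        rw [← Equiv.Perm.inv_eq_iff_eq, e]
      refine ⟨by rw [e'], fun hn => ?_⟩
      have hc : t ≠ c := fun hc => hn (Or.inl (e'.2 hc))
      rw [e]
      refine Fin.ext ?_
      have h1 : (t : ℕ) ≠ c := fun h => hc (Fin.ext h)
      have h2 := c.2
      rw [coe_cycleRange, if_neg hc, if_neg]
      rw [Fin.lt_def]
      omega

theorem mem_of_comesFirst {b : ℕ} {i j : Fin b} (hij : i < j) {w : List (Fin b)} (hj : j ∈ w)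
    (h : comesFirst i j w = true) : i ∈ w := by
  induction w with
  | nil => cases hj
  | cons x w ih =>
    by_cases h1 : x = i
    · simp [h1]
    · by_cases h2 : x = j
      · subst h2
        simp [comesFirst, h1] at h
      · refine List.mem_cons_of_mem _ (ih ?_ ?_)
        · simpa [Ne.symm h2] using hj
        · simpa [comesFirst, h1, h2] using h

/-- The only increasing permutation of a finite chain is the identity. -/
theorem listPerm_eq_one_iff {b : ℕ} (l : List (Card b)) :
    listPerm l = 1 ↔ ∀ i j : Fin b, i < j → comesFirst i j (ballWord l) = true := by
  constructor
  · intro h i j hij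
    rw [comesFirst_ballWord hij, h]
    simpa using hij
  · intro h
    have hm : StrictMono ⇑(listPerm l)⁻¹ := fun i j hij => (comesFirst_ballWord hij l).1 (h i j hij)
    have e : hm.orderIsoOfSurjective _ (listPerm l)⁻¹.surjective = OrderIso.refl _ :=
      Subsingleton.elim _ _
    rw [← inv_eq_one]
    ext y
    exact congrArg Fin.val (DFunLike.congr_fun e y)

theorem inOrder_ballWord_iff {b : ℕ} (hb : 1 ≤ b) (l : List (Card b)) :
    InOrder 0 (ballWord l) ↔ (∃ c ∈ l, label c = b) ∧ listPerm l = 1 := by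
  rw [inOrder_iff (Nat.zero_le b), listPerm_eq_one_iff]
  simp only [Nat.zero_le, forall_true_left]
  refine and_congr_left fun h => ?_
  have ht : ((⟨b - 1, by omega⟩ : Fin b) : ℕ) + 1 = b := by simp; omega
  have e : (∃ c ∈ l, label c = b) ↔ (⟨b - 1, by omega⟩ : Fin b) ∈ l := by
    constructor
    · rintro ⟨c, hc, hcb⟩
      have : c = ⟨b - 1, by omega⟩ := Fin.ext (by simp only [label] at hcb; simp; omega)
      rwa [← this]
    · exact fun hc => ⟨_, hc, ht⟩
  rw [e, ← (mem_ballWord_top ht l).1]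
  refine ⟨fun h => h _, fun hmem x => ?_⟩
  -- Every smaller letter comes before the top one, so it occurs as well.
  rcases lt_or_ge x ⟨b - 1, by omega⟩ with hx | hx
  · exact mem_of_comesFirst hx hmem (h _ _ hx)
  · have : x = ⟨b - 1, by omega⟩ := le_antisymm (Fin.le_def.2 (by have := x.2; simp; omega)) hx
    rwa [this]

theorem completes_ballWord_iff {b : ℕ} (hb : 1 ≤ b) (l : List (Card b)) :
    Completes [] 1 (ballWord l) ↔ (∃ c ∈ l, label c = b) ∧ listPerm l = 1 ∧
      (l.map Fin.val).sum = b * (b - 1) + 2 := by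
  rw [isHistory_nil.completes_iff (Nat.zero_le b), List.length_nil, inOrder_ballWord_iff hb,
    and_assoc]
  refine and_congr_right fun _ => and_congr_right fun h => ?_
  -- With empty history all flags are `true`, and the identity permutation makes `comesFirst` true,
  -- so both corrections in `two_mul_ascents` vanish.
  have key : 2 * totalAscents [] (ballWord l) = (l.map Fin.val).sum := by
    rw [sum_eq_pairSum_alternations, two_mul, totalAscents, ← pairSum_add]
    refine pairSum_congr fun i j hij => ?_
    have := two_mul_ascents hij.ne true (ballWord l)
    rw [(listPerm_eq_one_iff l).1 h i j hij] at this
    simp at this ⊢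
    omega
  have hs := Finset.sum_range_id_mul_two b
  rw [← key, ← Finset.range_eq_Ico]
  omega

theorem card_rows {α : Type*} (n : ℕ) (P : List α → Prop) :
    Nat.card {A : Fin n → α // P (List.ofFn A)} = wordCount n P := by
  refine Nat.card_congr (Equiv.ofBijective (fun A => ⟨List.ofFn A.1, List.length_ofFn, A.2⟩)
    ⟨fun A B h => Subtype.ext (List.ofFn_injective (congrArg Subtype.val h)), ?_⟩)
  rintro ⟨l, rfl, hl⟩
  exact ⟨⟨l.get, by rwa [List.ofFn_get]⟩, Subtype.ext (List.ofFn_get l)⟩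

end Juggling

theorem mainTheorem6 (b n : ℕ) (hb : 1 ≤ b) :
    Nat.card {A : Fin n → Juggling.Card b // Juggling.UsesTopCard A ∧ Juggling.seqPerm A = 1 ∧
        Juggling.crossings A = b * (b - 1) + 2} =
      Juggling.binom n ((b : ℤ) + 2) * Juggling.binom n ((b : ℤ) - 2) := by
  rw [← Juggling.wordCount_completes_nil, ← Juggling.wordCount_ballWord, ← Juggling.card_rows]
  refine Nat.card_congr (Equiv.subtypeEquivRight fun A => ?_)
  rw [Juggling.completes_ballWord_iff hb, List.map_ofFn, List.sum_ofFn]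
  simp [Juggling.UsesTopCard, Juggling.seqPerm, Juggling.crossings, Juggling.label, List.mem_ofFn]
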